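/- Let $(Z,\mathcal Z,\pi)$ be a Lebesgue space, i.e. a complete probability space isomorphic modulo null sets to the union of a subinterval of $[0,1]$ (with the Lebesgue $\sigma$-field and Lebesgue measure) and a countable set of atoms. Let $T:Z\to Z$ be an invertible (bimeasurable) measure-preserving map which is aperiodic, i.e. $\pi\{z : \exists n\ge 1,\ T^n(z)=z\}=0$, and has finite entropy $h(T)<\infty$. Let $\mathcal B$ be a factor of $T$, i.e. a sub-$\sigma$-field of $\mathcal Z$ with $T^{-1}\mathcal B=\mathcal B=T\mathcal B$ modulo $\pi$-null sets, with finite entropy, and let $$\mathcal B' := \{A\in\mathcal Z : h(T,\{A,A^c\}\,|\,\mathcal B)=0\},\qquad h(T,\{A,A^c\}\,|\,\mathcal B)=\lim_{n\to\infty}\frac1n H\Big(\bigvee_{k=0}^{n-1}\{T^{-k}A,T^{-k}A^c\}\,\Big|\,\mathcal B\Big),$$ be the conditional Pinsker factor associated with $\mathcal B$. Let $\gamma$ be any generator of $T$ with finite entropy, i.e. a countable measurable partition of $Z$ with $H(\gamma)<\infty$ such that the partitions $T^k\gamma$, $k\in\mathbb Z$, generate $\mathcal Z$ modulo null sets. Then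 $$\mathcal B' = \overline{\bigcap_{n\ge 0}\Big(\mathcal B\vee\bigvee_{k\ge n}T^{-k}\gamma\Big)},$$ where $\bigvee_{k\ge n}T^{-k}\gamma$ stands for the $\sigma$-field generated by the partitions $T^{-k}\gamma$, $k\ge n$, and the bar denotes completion with respect to $\pi$. -/

import Mathlib

open MeasureTheory Filter

noncomputable section

namespace CondPinsker

/-! ### Lebesgue spaces -/

/-- Two measure spaces are isomorphic modulo null sets: after removing measurable null sets there
is a bimeasurable measure-preserving bijection between them. -/
def IsoModZero {X Y : Type*} [MeasurableSpace X] [MeasurableSpace Y]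
    (μ : Measure X) (ν : Measure Y) : Prop :=
  ∃ (s : Set X) (t : Set Y), MeasurableSet s ∧ MeasurableSet t ∧ μ sᶜ = 0 ∧ ν tᶜ = 0 ∧
    ∃ e : s ≃ᵐ t,
      MeasurePreserving e (μ.comap (Subtype.val : s → X)) (ν.comap (Subtype.val : t → Y))

/-- Lebesgue measure on the interval `[a, b]`, together with a countable set of atoms: the `i`-th
atom (a point outside the interval) has mass `p i`. -/
def lebesgueModel (a b : ℝ) (p : ℕ → ENNReal) : Measure (ℝ ⊕ ℕ) :=
  (volume.restrict (Set.Icc a b)).map Sum.inl +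
    Measure.sum (fun i => p i • Measure.dirac (Sum.inr i))

/-- `(Z, π)` is a Lebesgue space: a complete probability space which is isomorphic modulo null sets
to the union of a subinterval of `[0, 1]`, with the Lebesgue `σ`-field and Lebesgue measure, and a
countable set of atoms. -/
structure IsLebesgueSpace {Z : Type*} [MeasurableSpace Z] (π : Measure Z) : Prop where
  isProbabilityMeasure : IsProbabilityMeasure π
  isComplete : π.IsComplete
  iso : ∃ (a b : ℝ) (p : ℕ → ENNReal), 0 ≤ a ∧ a ≤ b ∧ b ≤ 1 ∧
    IsoModZero (Y := NullMeasurableSpace (ℝ ⊕ ℕ) (lebesgueModel a b p)) π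
      (lebesgueModel a b p).completion

/-! ### `σ`-fields modulo null sets -/

variable {Z : Type*}

/-- `𝒜 ⊂ ℬ` modulo `π`. -/
def SubsetMod (𝒜 ℬ : MeasurableSpace Z) [MeasurableSpace Z] (π : Measure Z) : Prop :=
  ∀ s, MeasurableSet[𝒜] s → ∃ t, MeasurableSet[ℬ] t ∧ π (symmDiff s t) = 0

/-- `𝒜 = ℬ` modulo `π`. -/
def EqMod (𝒜 ℬ : MeasurableSpace Z) [MeasurableSpace Z] (π : Measure Z) : Prop :=
  SubsetMod 𝒜 ℬ π ∧ SubsetMod ℬ 𝒜 π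

/-- The completion of a `σ`-field with respect to `π`: all sets that differ from a member of the
`σ`-field by a `π`-null set. -/
abbrev completionField (𝒢 : MeasurableSpace Z) [MeasurableSpace Z] (π : Measure Z) :
    MeasurableSpace Z :=
  eventuallyMeasurableSpace 𝒢 (ae π)

/-- A factor of `T`: a sub-`σ`-field `ℬ` with `T⁻¹ℬ = ℬ = Tℬ` modulo `π`. Here `ℬ.comap T` is
`T⁻¹ℬ = {T⁻¹ B : B ∈ ℬ}` and `ℬ.comap T.symm` is `Tℬ = {T B : B ∈ ℬ}`. -/
structure IsFactor (ℬ : MeasurableSpace Z) [m : MeasurableSpace Z] (π : Measure Z)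
    (T : Z ≃ᵐ Z) : Prop where
  le : ℬ ≤ m
  preimage : EqMod (ℬ.comap T) ℬ π
  image : EqMod (ℬ.comap T.symm) ℬ π

/-- `T` is aperiodic: almost no point is periodic. -/
def IsAperiodic [MeasurableSpace Z] (π : Measure Z) (T : Z ≃ᵐ Z) : Prop :=
  π {z | ∃ n : ℕ, 1 ≤ n ∧ T^[n] z = z} = 0

/-! ### Countable partitions and entropy

A countable partition is given by a labelling `α : Z → Λ` of the points by a countable set `Λ`;
its blocks are the non-empty fibres `α ⁻¹' {l}`. -/

variable {Λ : Type*}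

/-- All blocks of the partition `α` belong to the `σ`-field `ℱ`. -/
def BlocksIn (ℱ : MeasurableSpace Z) (α : Z → Λ) : Prop :=
  ∀ l, MeasurableSet[ℱ] (α ⁻¹' {l})

/-- The `σ`-field generated by a countable partition, which consists of all unions of blocks. -/
abbrev partitionField (α : Z → Λ) : MeasurableSpace Z :=
  MeasurableSpace.comap α ⊤

/-- The conditional information `I_{α|ℱ} = ∑_{A ∈ α} (-log₂ π(A|ℱ)) 1_A`: at the point `z` only the
block `A` containing `z` contributes. (The set of points `z ∈ A` with `π(A|ℱ)(z) ∉ (0, 1]` is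
null, so that the conventions outside `(0, 1]` do not matter.) -/
def condInformation (ℱ : MeasurableSpace Z) [MeasurableSpace Z] (π : Measure Z) (α : Z → Λ)
    (z : Z) : ENNReal :=
  ENNReal.ofReal (-Real.logb 2 ((π[(α ⁻¹' {α z}).indicator (fun _ => (1 : ℝ)) | ℱ]) z))

/-- The conditional entropy `H(α|ℱ) = E[I_{α|ℱ}]`, in `[0, ∞]`. -/
def condEntropy (ℱ : MeasurableSpace Z) [MeasurableSpace Z] (π : Measure Z) (α : Z → Λ) :
    ENNReal :=
  ∫⁻ z, condInformation ℱ π α z ∂π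

/-- The entropy `H(α)`: the conditional entropy given the trivial `σ`-field. -/
def entropy [MeasurableSpace Z] (π : Measure Z) (α : Z → Λ) : ENNReal :=
  condEntropy ⊥ π α

/-- The partition `α ∨ T⁻¹α ∨ ⋯ ∨ T⁻⁽ⁿ⁻¹⁾α`: the label of `z` is the word
`(α z, α (T z), …, α (Tⁿ⁻¹ z))`. -/
def itinerary (T : Z → Z) (α : Z → Λ) (n : ℕ) (z : Z) : Fin n → Λ :=
  fun k => α (T^[k] z)

/-- `h(T, α|ℬ) = lim_n (1/n) H(α ∨ T⁻¹α ∨ ⋯ ∨ T⁻⁽ⁿ⁻¹⁾α | ℬ)`. For a factor `ℬ` the limit exists in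
`[0, ∞]`; it is written as an upper limit so that it is defined in all cases. -/
def condEntropyRate (ℬ : MeasurableSpace Z) [MeasurableSpace Z] (π : Measure Z) (T : Z ≃ᵐ Z)
    (α : Z → Λ) : ENNReal :=
  limsup (fun n : ℕ => condEntropy ℬ π (itinerary T α n) / n) atTop

/-- `h(T, α) = lim_n (1/n) H(α ∨ T⁻¹α ∨ ⋯ ∨ T⁻⁽ⁿ⁻¹⁾α)`. -/
def entropyRate [MeasurableSpace Z] (π : Measure Z) (T : Z ≃ᵐ Z) (α : Z → Λ) : ENNReal :=
  limsup (fun n : ℕ => entropy π (itinerary T α n) / n) atTop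

/-- The entropy `h(T, ℬ)` of the factor `ℬ`: the supremum of `h(T, α)` over all finite partitions
`α` with blocks in `ℬ`. -/
def factorEntropy (ℬ : MeasurableSpace Z) [MeasurableSpace Z] (π : Measure Z) (T : Z ≃ᵐ Z) :
    ENNReal :=
  ⨆ (n : ℕ) (α : Z → Fin n) (_ : BlocksIn ℬ α), entropyRate π T α

/-- The entropy `h(T)`: the supremum of `h(T, α)` over all finite measurable partitions. -/
def systemEntropy [m : MeasurableSpace Z] (π : Measure Z) (T : Z ≃ᵐ Z) : ENNReal :=
  factorEntropy m π T

/-- The countable partition `γ` is a generator of `T`: it is measurable, and the partitions `T^k γ`,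
`k ∈ ℤ`, generate the whole `σ`-field modulo null sets. -/
structure IsGenerator [m : MeasurableSpace Z] (π : Measure Z) (T : Z ≃ᵐ Z) (γ : Z → Λ) :
    Prop where
  measurable : BlocksIn m γ
  generates : EqMod
    (⨆ k : ℤ, partitionField (fun z => γ (((T.toEquiv : Equiv.Perm Z) ^ k) z))) m π

/-- The conditional Pinsker factor `ℬ' = {A ∈ 𝒵 : h(T, {A, Aᶜ}|ℬ) = 0}`. The partition `{A, Aᶜ}` is
given by the labelling `z ↦ (z ∈ A)`. -/
def condPinskerFactor (ℬ : MeasurableSpace Z) [MeasurableSpace Z] (π : Measure Z) (T : Z ≃ᵐ Z) :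
    Set (Set Z) :=
  {A | MeasurableSet A ∧ condEntropyRate ℬ π T (fun z => z ∈ A) = 0}

/-- The `σ`-field `⋂_{n ≥ 0} (ℬ ∨ ⋁_{k ≥ n} T⁻ᵏγ)`. -/
abbrev tailField (ℬ : MeasurableSpace Z) (T : Z → Z) (γ : Z → Λ) : MeasurableSpace Z :=
  ⨅ n : ℕ, (ℬ ⊔ ⨆ (k : ℕ) (_ : n ≤ k), partitionField (fun z => γ (T^[k] z)))

end CondPinsker

end

open MeasureTheory Filter
open scoped ENNReal Topology

namespace CondPinsker

set_option linter.unusedSectionVars false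

/-! Replace `ℬ` by its completion, so that it contains all null sets and T⁻¹ℬ = ℬ holds exactly.
Write F_q for the join of `ℬ` with all T⁻ᵏγ, k ≥ q. The F_q decrease, and a set lies in the
completed tail field iff it lies in every F_q. Let α = {A, Aᶜ}, let αⁿ and γⁿ be the n-step
itineraries, and let c = H(γ|F_1), which is finite.

Suppose α has rate zero. By the chain rule and stationarity, n·c is the entropy of n successive
copies of γ given their future and `ℬ`. Conditioning also on an α-itinerary costs at most its
entropy given `ℬ`, which is o(n). Hence a single T⁻ᵖα cannot lower H(T^{-q}γ|F_{q+1}) = c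
(`condEntropy_sup_eq_of_rate_zero`). By symmetry of mutual information H(T⁻ᵖα|F_q) does not depend
on q. Stationarity turns this into H(α|F_q) = H(α|TᵖF_0) for all p; since TᵖF_0 increases to the
full σ-field, the common value is 0 (`condEntropy_futureField_eq_zero_of_rate_zero`).

Conversely, let α be measurable in every F_q. Then H(γⁿ|ℬ ∨ αⁿ) ≥ H(γⁿ|F_n) = n·c, so the joint
entropy of γⁿ and αⁿ given `ℬ` is at least H(αⁿ|ℬ) + n·c. Its increments are bounded by a sequence
tending to c, which leaves o(n) for H(αⁿ|ℬ) (`limsup_condEntropy_eq_zero_of_le_futureField`).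

The analytic inputs are the chain rule, Jensen's inequality and martingale convergence. -/

variable {Z Λ Λ' : Type*}


/-! ### Conditional probabilities -/

section CondProb

/-- The conditional probability `π(A|ℱ)`. -/
noncomputable abbrev condProb (ℱ : MeasurableSpace Z) [MeasurableSpace Z] (π : Measure Z)
    (A : Set Z) : Z → ℝ :=
  π[A.indicator (fun _ => (1 : ℝ)) | ℱ]

variable {ℱ 𝒢 : MeasurableSpace Z} [m : MeasurableSpace Z] {π : Measure Z}
  [IsProbabilityMeasure π] {A B : Set Z}

lemma integrable_indicator_one (hA : MeasurableSet A) :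
    Integrable (A.indicator (fun _ => (1 : ℝ))) π :=
  (integrable_const 1).indicator hA

lemma measurable_condProb : Measurable[ℱ] (condProb ℱ π A) :=
  stronglyMeasurable_condExp.measurable

lemma measurable_condProb' (hℱ : ℱ ≤ m) : Measurable (condProb ℱ π A) :=
  measurable_condProb.mono hℱ le_rfl

lemma condProb_nonneg : ∀ᵐ z ∂π, 0 ≤ condProb ℱ π A z :=
  condExp_nonneg (ae_of_all _ fun z => Set.indicator_nonneg (fun _ _ => zero_le_one) z)

lemma condProb_mono (hA : MeasurableSet A) (hB : MeasurableSet B) (h : A ⊆ B) :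
    ∀ᵐ z ∂π, condProb ℱ π A z ≤ condProb ℱ π B z :=
  condExp_mono (integrable_indicator_one hA) (integrable_indicator_one hB)
    (ae_of_all _ fun z => Set.indicator_le_indicator_of_subset h (fun _ => zero_le_one) z)

lemma condProb_le_one (hℱ : ℱ ≤ m) (hA : MeasurableSet A) :
    ∀ᵐ z ∂π, condProb ℱ π A z ≤ 1 := by
  filter_upwards [condProb_mono (π := π) (ℱ := ℱ) hA MeasurableSet.univ (Set.subset_univ A)]
    with z hz
  refine hz.trans_eq ?_
  simp only [condProb, Set.indicator_univ]
  rw [condExp_const hℱ]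

lemma setIntegral_condProb (hℱ : ℱ ≤ m) (hA : MeasurableSet A) {C : Set Z}
    (hC : MeasurableSet[ℱ] C) : ∫ z in C, condProb ℱ π A z ∂π = π.real (A ∩ C) := by
  rw [setIntegral_condExp hℱ (integrable_indicator_one hA) hC, integral_indicator hA,
    Measure.restrict_restrict hA]
  simp

/-- On `ℱ`, the restriction of π to `A` has density π(A|ℱ). Arguing with measures avoids any
integrability assumption on `g`, which will be an unbounded logarithm. -/
lemma setLIntegral_eq_lintegral_condProb_mul (hℱ : ℱ ≤ m) (hA : MeasurableSet A)
    {g : Z → ℝ≥0∞} (hg : Measurable[ℱ] g) :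
    ∫⁻ z in A, g z ∂π = ∫⁻ z, ENNReal.ofReal (condProb ℱ π A z) * g z ∂π := by
  have hP : Measurable[ℱ] fun z => ENNReal.ofReal (condProb ℱ π A z) :=
    measurable_condProb.ennreal_ofReal
  have key : (π.restrict A).trim hℱ
      = (π.trim hℱ).withDensity fun z => ENNReal.ofReal (condProb ℱ π A z) := by
    refine @Measure.ext Z ℱ _ _ fun C hC => ?_
    rw [trim_measurableSet_eq hℱ hC, Measure.restrict_apply (hℱ _ hC),
      withDensity_apply _ hC, setLIntegral_trim hℱ hP hC,
      ← ofReal_integral_eq_lintegral_ofReal integrable_condExp.integrableOn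
        (ae_restrict_of_ae condProb_nonneg), setIntegral_condProb hℱ hA hC, Set.inter_comm]
    simp [Measure.real]
  rw [← lintegral_trim hℱ hg, key, lintegral_withDensity_eq_lintegral_mul _ hP hg,
    lintegral_trim hℱ (hP.mul hg)]
  rfl

lemma condProb_pos (hℱ : ℱ ≤ m) (hA : MeasurableSet A) :
    ∀ᵐ z ∂π, z ∈ A → 0 < condProb ℱ π A z := by
  have hS : MeasurableSet[ℱ] {z | condProb ℱ π A z ≤ 0} :=
    measurableSet_le measurable_condProb measurable_const
  have h := setIntegral_condProb (π := π) hℱ hA hS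
  have h0 : ∫ z in {z | condProb ℱ π A z ≤ 0}, condProb ℱ π A z ∂π ≤ 0 :=
    setIntegral_nonpos (hℱ _ hS) fun z hz => hz
  have h1 : π (A ∩ {z | condProb ℱ π A z ≤ 0}) = 0 := by
    have : π.real (A ∩ {z | condProb ℱ π A z ≤ 0}) = 0 :=
      le_antisymm (h ▸ h0) measureReal_nonneg
    simpa [Measure.real, ENNReal.toReal_eq_zero_iff] using this
  filter_upwards [measure_eq_zero_iff_ae_notMem.1 h1] with z hz hzA
  by_contra hle
  exact hz ⟨hzA, not_lt.1 hle⟩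

lemma condProb_of_measurableSet (hℱ : ℱ ≤ m) (hA : MeasurableSet[ℱ] A) :
    condProb ℱ π A = A.indicator fun _ => 1 :=
  condExp_of_stronglyMeasurable hℱ (stronglyMeasurable_const.indicator hA)
    (integrable_indicator_one (hℱ _ hA))

/-- On a block `A` of `ξ` every set of `ℱ ∨ σ(ξ)` coincides with a set of `ℱ`. -/
lemma exists_inter_eq_of_sup_partitionField {ξ : Z → Λ} {l : Λ} {D : Set Z}
    (hD : MeasurableSet[ℱ ⊔ partitionField ξ] D) :
    ∃ C, MeasurableSet[ℱ] C ∧ D ∩ ξ ⁻¹' {l} = C ∩ ξ ⁻¹' {l} := by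
  -- The sets whose trace on the block is the trace of an `ℱ`-set form a σ-field, so generators
  -- suffice; a union of blocks traces out everything or nothing.
  have hle : ℱ ⊔ partitionField ξ ≤
      (ℱ.comap (Subtype.val : ξ ⁻¹' {l} → Z)).map Subtype.val := by
    refine sup_le (MeasurableSpace.le_map_comap) ?_
    rintro _ ⟨S, -, rfl⟩
    change MeasurableSet[ℱ.comap _] _
    by_cases hl : l ∈ S
    · convert @MeasurableSet.univ _ (ℱ.comap (Subtype.val : ξ ⁻¹' {l} → Z))
      ext ⟨z, hz⟩
      simp only [Set.mem_preimage, Set.mem_singleton_iff] at hz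
      simp [hz, hl]
    · convert @MeasurableSet.empty _ (ℱ.comap (Subtype.val : ξ ⁻¹' {l} → Z))
      ext ⟨z, hz⟩
      simp only [Set.mem_preimage, Set.mem_singleton_iff] at hz
      simp [hz, hl]
  obtain ⟨C, hC, hCD⟩ := hle _ hD
  refine ⟨C, hC, ?_⟩
  rw [Set.inter_comm D, Set.inter_comm C]
  exact (Subtype.preimage_val_eq_preimage_val_iff _ _ _).1 hCD.symm

/-- If `𝒢 ⊇ ℱ` contains `A` and has the same trace on `A` as `ℱ`, then
`π(A ∩ B|ℱ) = π(A|ℱ) π(B|𝒢)` on `A`. -/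
lemma condProb_inter_eq_mul_of_trace (hℱ𝒢 : ℱ ≤ 𝒢) (h𝒢 : 𝒢 ≤ m) (hAG : MeasurableSet[𝒢] A)
    (htrace : ∀ D, MeasurableSet[𝒢] D → ∃ C, MeasurableSet[ℱ] C ∧ D ∩ A = C ∩ A)
    (hB : MeasurableSet B) :
    ∀ᵐ z ∂π, z ∈ A → condProb ℱ π (A ∩ B) z = condProb ℱ π A z * condProb 𝒢 π B z := by
  have hℱ : ℱ ≤ m := hℱ𝒢.trans h𝒢
  have hA : MeasurableSet A := h𝒢 _ hAG
  have hAB : MeasurableSet (A ∩ B) := hA.inter hB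
  -- The Bayes quotient: its restriction to `A` will be identified with π(A ∩ B|𝒢). Where the
  -- denominator vanishes the numerator does too, almost surely, so the value 0 of `q` there is
  -- harmless.
  set q : Z → ℝ := fun z => condProb ℱ π (A ∩ B) z / condProb ℱ π A z with hq
  have hqm : Measurable[ℱ] q :=
    Measurable.div (measurable_condProb (A := A ∩ B)) (measurable_condProb (A := A))
  have hq0 : ∀ᵐ z ∂π, 0 ≤ q z ∧ q z ≤ 1 ∧ q z * condProb ℱ π A z = condProb ℱ π (A ∩ B) z := by
    filter_upwards [condProb_nonneg (π := π) (ℱ := ℱ) (A := A),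
      condProb_nonneg (π := π) (ℱ := ℱ) (A := A ∩ B),
      condProb_mono (π := π) (ℱ := ℱ) hAB hA Set.inter_subset_left] with z h1 h2 h3
    refine ⟨div_nonneg h2 h1, div_le_one_of_le₀ h3 h1, ?_⟩
    by_cases h : condProb ℱ π A z = 0
    · rw [h, mul_zero]; exact (le_antisymm (h3.trans_eq h) h2).symm
    · exact div_mul_cancel₀ _ h
  have hqb : ∀ᵐ z ∂π, ‖q z‖ ≤ 1 := by
    filter_upwards [hq0] with z hz
    rw [Real.norm_of_nonneg hz.1]; exact hz.2.1
  have hpull : π[q * A.indicator (fun _ => (1 : ℝ)) | ℱ] =ᵐ[π] q * condProb ℱ π A :=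
    condExp_stronglyMeasurable_mul_of_bound hℱ hqm.stronglyMeasurable
      (integrable_indicator_one hA) 1 hqb
  have hint : Integrable (q * A.indicator (fun _ => (1 : ℝ))) π :=
    (integrable_indicator_one hA).bdd_mul (hqm.mono hℱ le_rfl).aestronglyMeasurable hqb
  have hind : q * A.indicator (fun _ => (1 : ℝ)) = A.indicator q := by
    ext z; by_cases hz : z ∈ A <;> simp [hz]
  have e1 : q * A.indicator (fun _ => (1 : ℝ)) =ᵐ[π] condProb 𝒢 π (A ∩ B) := by
    refine ae_eq_condExp_of_forall_setIntegral_eq h𝒢 (integrable_indicator_one hAB)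
      (fun _ _ _ => hint.integrableOn) (fun D hD _ => ?_)
      (((hqm.mono hℱ𝒢 le_rfl).stronglyMeasurable.mul
        (stronglyMeasurable_const.indicator hAG)).aestronglyMeasurable)
    -- Both integrands vanish off `A`, so the test set in `𝒢` may be exchanged for one in `ℱ`, where
    -- `q` can be pulled out.
    obtain ⟨C, hC, hCD⟩ := htrace D hD
    have l1 : ∫ z in D, (q * A.indicator (fun _ => (1 : ℝ))) z ∂π
        = ∫ z in C, (q * A.indicator (fun _ => (1 : ℝ))) z ∂π := by
      rw [hind, setIntegral_indicator hA, setIntegral_indicator hA, hCD]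
    have l2 : ∫ z in D, (A ∩ B).indicator (fun _ => (1 : ℝ)) z ∂π
        = ∫ z in C, (A ∩ B).indicator (fun _ => (1 : ℝ)) z ∂π := by
      rw [setIntegral_indicator hAB, setIntegral_indicator hAB, ← Set.inter_assoc,
        ← Set.inter_assoc, hCD]
    rw [l1, l2, ← setIntegral_condExp hℱ hint hC,
      ← setIntegral_condExp hℱ (integrable_indicator_one hAB) hC]
    refine integral_congr_ae (ae_restrict_of_ae ?_)
    filter_upwards [hpull, hq0] with z h1 h2
    rw [h1]; exact h2.2.2
  have e2 : condProb 𝒢 π (A ∩ B) =ᵐ[π] A.indicator (condProb 𝒢 π B) := by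
    have := condExp_indicator (μ := π) (integrable_indicator_one (π := π) hB) hAG
    rwa [Set.indicator_indicator] at this
  filter_upwards [e1, e2, hq0] with z h1 h2 h3 hz
  rw [← h3.2.2, mul_comm]
  rw [h2, Set.indicator_of_mem hz] at h1
  simp only [Pi.mul_apply, Set.indicator_of_mem hz, mul_one] at h1
  rw [h1]

lemma condProb_inter_eq_mul (hℱ : ℱ ≤ m) {ξ : Z → Λ}
    (hξ : partitionField ξ ≤ m) (l : Λ) (hB : MeasurableSet B) :
    ∀ᵐ z ∂π, z ∈ ξ ⁻¹' {l} → condProb ℱ π (ξ ⁻¹' {l} ∩ B) z =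
      condProb ℱ π (ξ ⁻¹' {l}) z * condProb (ℱ ⊔ partitionField ξ) π B z :=
  condProb_inter_eq_mul_of_trace le_sup_left (sup_le hℱ hξ)
    ((le_sup_right : partitionField ξ ≤ ℱ ⊔ partitionField ξ) _ ⟨{l}, trivial, rfl⟩)
    (fun _ hD => exists_inter_eq_of_sup_partitionField hD) hB

/-- Conditional probabilities depend on the `σ`-field only modulo null sets. -/
lemma condProb_congr_of_le (hℱ𝒢 : ℱ ≤ 𝒢) (h𝒢 : 𝒢 ≤ m) (h : SubsetMod 𝒢 ℱ π)
    (hA : MeasurableSet A) : condProb ℱ π A =ᵐ[π] condProb 𝒢 π A := by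
  have hℱ := hℱ𝒢.trans h𝒢
  refine ae_eq_condExp_of_forall_setIntegral_eq h𝒢 (integrable_indicator_one hA)
    (fun _ _ _ => integrable_condExp.integrableOn) (fun D hD _ => ?_)
    (measurable_condProb.mono hℱ𝒢 le_rfl).stronglyMeasurable.aestronglyMeasurable
  obtain ⟨C, hC, hCD⟩ := h D hD
  have hCD' : D =ᵐ[π] C := measure_symmDiff_eq_zero_iff.1 hCD
  rw [setIntegral_congr_set hCD', setIntegral_congr_set hCD']
  exact setIntegral_condExp hℱ (integrable_indicator_one hA) hC

lemma condProb_comap (hℱ : ℱ ≤ m) {T : Z → Z} (hT : MeasurePreserving T π π)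
    (hA : MeasurableSet A) :
    condProb (ℱ.comap T) π (T ⁻¹' A) =ᵐ[π] condProb ℱ π A ∘ T := by
  have hle : ℱ.comap T ≤ m := (MeasurableSpace.comap_mono hℱ).trans hT.measurable.comap_le
  have hm : Measurable[ℱ.comap T] (condProb ℱ π A ∘ T) := by
    intro s hs
    exact ⟨_, measurable_condProb hs, rfl⟩
  symm
  refine ae_eq_condExp_of_forall_setIntegral_eq hle
    (integrable_indicator_one (hT.measurable hA))
    (fun _ _ _ => ((hT.integrable_comp
      (measurable_condProb' hℱ).aestronglyMeasurable).2 integrable_condExp).integrableOn)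
    ?_ hm.stronglyMeasurable.aestronglyMeasurable
  rintro _ ⟨C, hC, rfl⟩ -
  have h1 : ∫ z in T ⁻¹' C, (condProb ℱ π A ∘ T) z ∂π = ∫ z in C, condProb ℱ π A z ∂π := by
    have := setIntegral_map (μ := π) (g := T) (hℱ _ hC)
      (measurable_condProb' (π := π) (A := A) hℱ).aestronglyMeasurable hT.measurable.aemeasurable
    rw [hT.map_eq] at this
    exact this.symm
  have h2 := hT.measure_preimage (hA.inter (hℱ _ hC)).nullMeasurableSet
  rw [h1, setIntegral_condProb hℱ hA hC, integral_indicator (hT.measurable hA),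
    Measure.restrict_restrict (hT.measurable hA), ← Set.preimage_inter]
  simp only [measureReal_def, integral_const, MeasurableSet.univ, Measure.restrict_apply,
    Set.univ_inter, smul_eq_mul, mul_one, h2]

end CondProb


/-! ### Fields of countable partitions -/

section Partitions

lemma partitionField_le_of_blocksIn [Countable Λ] {ℱ : MeasurableSpace Z} {ξ : Z → Λ}
    (h : BlocksIn ℱ ξ) : partitionField ξ ≤ ℱ := by
  rintro _ ⟨S, -, rfl⟩
  rw [← Set.biUnion_preimage_singleton]
  exact MeasurableSet.biUnion S.to_countable fun l _ => h l

lemma measurableSet_block {ℱ : MeasurableSpace Z} {ξ : Z → Λ} (h : partitionField ξ ≤ ℱ) (l : Λ) :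
    MeasurableSet[ℱ] (ξ ⁻¹' {l}) :=
  h _ ⟨{l}, trivial, rfl⟩

lemma partitionField_prod [Countable Λ] [Countable Λ'] (ξ : Z → Λ) (η : Z → Λ') :
    partitionField (fun z => (ξ z, η z)) = partitionField ξ ⊔ partitionField η := by
  refine le_antisymm (partitionField_le_of_blocksIn fun l => ?_) (sup_le ?_ ?_)
  · have : (fun z => (ξ z, η z)) ⁻¹' {l} = ξ ⁻¹' {l.1} ∩ η ⁻¹' {l.2} := by
      ext z; simp [Prod.ext_iff]
    rw [this]
    exact MeasurableSet.inter (measurableSet_block le_sup_left _)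
      (measurableSet_block le_sup_right _)
  · rintro _ ⟨S, -, rfl⟩
    exact ⟨Prod.fst ⁻¹' S, trivial, rfl⟩
  · rintro _ ⟨S, -, rfl⟩
    exact ⟨Prod.snd ⁻¹' S, trivial, rfl⟩

lemma partitionField_comap (ξ : Z → Λ) (T : Z → Z) :
    (partitionField ξ).comap T = partitionField (ξ ∘ T) :=
  MeasurableSpace.comap_comp

lemma partitionField_congr {ξ : Z → Λ} {η : Z → Λ'} (h : ∀ z w, ξ z = ξ w ↔ η z = η w) :
    partitionField ξ = partitionField η := by
  refine le_antisymm ?_ ?_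
  · rintro _ ⟨S, -, rfl⟩
    refine ⟨η '' (ξ ⁻¹' S), trivial, ?_⟩
    ext z
    simp only [Set.mem_preimage, Set.mem_image]
    exact ⟨fun ⟨w, hw, hwz⟩ => (h w z).2 hwz ▸ hw, fun hz => ⟨z, hz, rfl⟩⟩
  · rintro _ ⟨S, -, rfl⟩
    refine ⟨ξ '' (η ⁻¹' S), trivial, ?_⟩
    ext z
    simp only [Set.mem_preimage, Set.mem_image]
    exact ⟨fun ⟨w, hw, hwz⟩ => (h w z).1 hwz ▸ hw, fun hz => ⟨z, hz, rfl⟩⟩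

end Partitions

/-! ### Conditional entropy: chain rule, monotonicity, continuity -/

/-- The contribution `E[-π(A|ℱ) log₂ π(A|ℱ)]` of a block `A` to the conditional entropy. -/
noncomputable def blockEntropy (ℱ : MeasurableSpace Z) [MeasurableSpace Z] (π : Measure Z)
    (A : Set Z) : ℝ≥0∞ :=
  ∫⁻ z, ENNReal.ofReal (Real.negMulLog (condProb ℱ π A z) / Real.log 2) ∂π

section Entropy

variable {ℱ 𝒢 : MeasurableSpace Z} {F : ℕ → MeasurableSpace Z} [m : MeasurableSpace Z]
  {π : Measure Z} [IsProbabilityMeasure π] {A B : Set Z} {ξ : Z → Λ} {η : Z → Λ'}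

lemma condInformation_eq (z : Z) : condInformation ℱ π ξ z =
    ENNReal.ofReal (-Real.logb 2 (condProb ℱ π (ξ ⁻¹' {ξ z}) z)) :=
  rfl

lemma measurable_neg_logb_condProb :
    Measurable[ℱ] fun z => ENNReal.ofReal (-Real.logb 2 (condProb ℱ π A z)) :=
  ((Real.measurable_log.comp measurable_condProb).div_const (Real.log 2)).neg.ennreal_ofReal

lemma measurable_condInformation [Countable Λ] (hℱ : ℱ ≤ m) (hξ : partitionField ξ ≤ m) :
    Measurable (condInformation ℱ π ξ) := by
  intro s hs
  have h : condInformation ℱ π ξ ⁻¹' s = ⋃ l, ξ ⁻¹' {l} ∩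
      (fun z => ENNReal.ofReal (-Real.logb 2 (condProb ℱ π (ξ ⁻¹' {l}) z))) ⁻¹' s := by
    ext z
    simp only [Set.mem_iUnion, Set.mem_inter_iff, Set.mem_preimage, Set.mem_singleton_iff,
      exists_eq_left', condInformation_eq]
  rw [h]
  exact MeasurableSet.iUnion fun l =>
    (measurableSet_block hξ l).inter (hℱ _ (measurable_neg_logb_condProb hs))

lemma condEntropy_congr_partition (h : ∀ z w, ξ z = ξ w ↔ η z = η w) :
    condEntropy ℱ π ξ = condEntropy ℱ π η := by
  have : ∀ z, ξ ⁻¹' {ξ z} = η ⁻¹' {η z} := fun z => Set.ext fun w => h w z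
  simp only [condEntropy, condInformation, this]

/-- The chain rule `H(ξ ∨ η|ℱ) = H(ξ|ℱ) + H(η|ℱ ∨ ξ)`. -/
lemma condEntropy_prod [Countable Λ] [Countable Λ'] (hℱ : ℱ ≤ m) (hξ : partitionField ξ ≤ m)
    (hη : partitionField η ≤ m) :
    condEntropy ℱ π (fun z => (ξ z, η z)) =
      condEntropy ℱ π ξ + condEntropy (ℱ ⊔ partitionField ξ) π η := by
  have h𝒢 : ℱ ⊔ partitionField ξ ≤ m := sup_le hℱ hξ
  rw [condEntropy, condEntropy, condEntropy,
    ← lintegral_add_left (measurable_condInformation hℱ hξ)]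
  refine lintegral_congr_ae ?_
  have h1 : ∀ᵐ z ∂π, ∀ l l', z ∈ ξ ⁻¹' {l} → condProb ℱ π (ξ ⁻¹' {l} ∩ η ⁻¹' {l'}) z =
      condProb ℱ π (ξ ⁻¹' {l}) z * condProb (ℱ ⊔ partitionField ξ) π (η ⁻¹' {l'}) z :=
    ae_all_iff.2 fun l => ae_all_iff.2 fun l' =>
      condProb_inter_eq_mul hℱ hξ l (measurableSet_block hη l')
  have h2 : ∀ᵐ z ∂π, ∀ l, z ∈ ξ ⁻¹' {l} → 0 < condProb ℱ π (ξ ⁻¹' {l}) z :=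
    ae_all_iff.2 fun l => condProb_pos hℱ (measurableSet_block hξ l)
  have h3 : ∀ᵐ z ∂π, ∀ l, z ∈ η ⁻¹' {l} →
      0 < condProb (ℱ ⊔ partitionField ξ) π (η ⁻¹' {l}) z :=
    ae_all_iff.2 fun l => condProb_pos h𝒢 (measurableSet_block hη l)
  have h4 : ∀ᵐ z ∂π, ∀ l, condProb ℱ π (ξ ⁻¹' {l}) z ≤ 1 :=
    ae_all_iff.2 fun l => condProb_le_one hℱ (measurableSet_block hξ l)
  have h5 : ∀ᵐ z ∂π, ∀ l, condProb (ℱ ⊔ partitionField ξ) π (η ⁻¹' {l}) z ≤ 1 :=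
    ae_all_iff.2 fun l => condProb_le_one h𝒢 (measurableSet_block hη l)
  filter_upwards [h1, h2, h3, h4, h5] with z h1 h2 h3 h4 h5
  have hset : (fun z => (ξ z, η z)) ⁻¹' {(ξ z, η z)} = ξ ⁻¹' {ξ z} ∩ η ⁻¹' {η z} := by
    ext w; simp
  have e := h1 (ξ z) (η z) rfl
  have p1 := h2 (ξ z) rfl
  have p2 := h3 (η z) rfl
  rw [condInformation_eq, condInformation_eq, condInformation_eq, hset, e, Real.logb_mul p1.ne' p2.ne', neg_add, ENNReal.ofReal_add]
  · exact neg_nonneg.2 (Real.logb_nonpos one_lt_two p1.le (h4 _))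
  · exact neg_nonneg.2 (Real.logb_nonpos one_lt_two p2.le (h5 _))

lemma condEntropy_eq_tsum [Countable Λ] (hℱ : ℱ ≤ m) (hξ : partitionField ξ ≤ m) :
    condEntropy ℱ π ξ = ∑' l, blockEntropy ℱ π (ξ ⁻¹' {l}) := by
  have hU : ⋃ l, ξ ⁻¹' {l} = Set.univ := by
    ext z; simp
  rw [condEntropy, ← setLIntegral_univ, ← hU, lintegral_iUnion (measurableSet_block hξ)
    (fun l l' hl => Disjoint.preimage _ (by simpa using hl))]
  refine tsum_congr fun l => ?_
  have hA := measurableSet_block hξ l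
  have h1 : ∫⁻ z in ξ ⁻¹' {l}, condInformation ℱ π ξ z ∂π = ∫⁻ z in ξ ⁻¹' {l},
      ENNReal.ofReal (-Real.logb 2 (condProb ℱ π (ξ ⁻¹' {l}) z)) ∂π := by
    refine setLIntegral_congr_fun hA fun z hz => ?_
    have hz' : ξ z = l := hz
    simp only [condInformation, hz']
  rw [h1, setLIntegral_eq_lintegral_condProb_mul hℱ hA
    measurable_neg_logb_condProb, blockEntropy]
  refine lintegral_congr_ae ?_
  filter_upwards [condProb_nonneg (π := π) (ℱ := ℱ) (A := ξ ⁻¹' {l})] with z hz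
  rw [← ENNReal.ofReal_mul hz, Real.logb, Real.negMulLog]
  congr 1
  ring

lemma integrable_negMulLog_condProb (hℱ : ℱ ≤ m) (hA : MeasurableSet A) :
    Integrable (Real.negMulLog ∘ condProb ℱ π A) π := by
  refine Integrable.of_bound
    (Real.continuous_negMulLog.measurable.comp (measurable_condProb' hℱ)).aestronglyMeasurable 1 ?_
  filter_upwards [condProb_nonneg (π := π) (ℱ := ℱ) (A := A), condProb_le_one (π := π) hℱ hA]
    with z h0 h1
  rw [Function.comp_apply, Real.norm_of_nonneg (Real.negMulLog_nonneg h0 h1)]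
  linarith [Real.negMulLog_le_one_sub_self h0]

lemma blockEntropy_eq_ofReal_integral (hℱ : ℱ ≤ m) (hA : MeasurableSet A) :
    blockEntropy ℱ π A =
      ENNReal.ofReal ((∫ z, Real.negMulLog (condProb ℱ π A z) ∂π) / Real.log 2) := by
  rw [← integral_div, blockEntropy, ofReal_integral_eq_lintegral_ofReal
    (f := fun z => Real.negMulLog (condProb ℱ π A z) / Real.log 2)
    ((integrable_negMulLog_condProb hℱ hA).div_const _)]
  filter_upwards [condProb_nonneg (π := π) (ℱ := ℱ) (A := A), condProb_le_one (π := π) hℱ hA]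
    with z h0 h1
  exact div_nonneg (Real.negMulLog_nonneg h0 h1) (Real.log_nonneg one_le_two)

/-- Conditional Jensen for the concave function -x log x, combined with the tower property. -/
lemma blockEntropy_anti (hℱ𝒢 : ℱ ≤ 𝒢) (h𝒢 : 𝒢 ≤ m) (hA : MeasurableSet A) :
    blockEntropy 𝒢 π A ≤ blockEntropy ℱ π A := by
  have hℱ := hℱ𝒢.trans h𝒢
  rw [blockEntropy_eq_ofReal_integral h𝒢 hA, blockEntropy_eq_ofReal_integral hℱ hA]
  have h2 : (0 : ℝ) ≤ Real.log 2 := Real.log_nonneg one_le_two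
  refine ENNReal.ofReal_le_ofReal (div_le_div_of_nonneg_right ?_ h2)
  have hJ := Real.concaveOn_negMulLog.condExp_map_le (μ := π) hℱ
    (Real.continuous_negMulLog.upperSemicontinuous.upperSemicontinuousOn _)
    (condProb_nonneg (π := π) (ℱ := 𝒢) (A := A)) isClosed_Ici integrable_condExp
    (integrable_negMulLog_condProb h𝒢 hA)
  have hT : π[condProb 𝒢 π A | ℱ] =ᵐ[π] condProb ℱ π A := condExp_condExp_of_le hℱ𝒢 h𝒢
  have e : ∫ z, Real.negMulLog (condProb 𝒢 π A z) ∂π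
      = ∫ z, (π[Real.negMulLog ∘ condProb 𝒢 π A | ℱ]) z ∂π := (integral_condExp hℱ).symm
  rw [e]
  refine integral_mono_ae integrable_condExp (integrable_negMulLog_condProb hℱ hA) ?_
  filter_upwards [hJ, hT] with z h1 h2
  simpa only [Function.comp_apply, h2] using h1

lemma condEntropy_anti [Countable Λ] (hℱ𝒢 : ℱ ≤ 𝒢) (h𝒢 : 𝒢 ≤ m) (hξ : partitionField ξ ≤ m) :
    condEntropy 𝒢 π ξ ≤ condEntropy ℱ π ξ := by
  rw [condEntropy_eq_tsum h𝒢 hξ, condEntropy_eq_tsum (hℱ𝒢.trans h𝒢) hξ]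
  exact ENNReal.tsum_le_tsum fun l => blockEntropy_anti hℱ𝒢 h𝒢 (measurableSet_block hξ l)

/-- Lévy's upward theorem inside a dominated integral: -x log x ≤ 1 - x ≤ 1 supplies the constant
bound. -/
lemma tendsto_blockEntropy (hF : Monotone F) (hFm : ∀ n, F n ≤ m) (A : Set Z) :
    Tendsto (fun n => blockEntropy (F n) π A) atTop (𝓝 (blockEntropy (⨆ n, F n) π A)) := by
  have hsup : ⨆ n, F n ≤ m := iSup_le hFm
  let 𝓕 : Filtration ℕ m := ⟨F, hF, hFm⟩
  refine tendsto_lintegral_of_dominated_convergence (fun _ => ENNReal.ofReal (1 / Real.log 2))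
    (fun n => ((Real.continuous_negMulLog.measurable.comp
      (measurable_condProb' (hFm n))).div_const _).ennreal_ofReal) (fun n => ?_) (by simp) ?_
  · filter_upwards [condProb_nonneg (π := π) (ℱ := F n) (A := A)] with z h0
    refine ENNReal.ofReal_le_ofReal (div_le_div_of_nonneg_right ?_ (Real.log_nonneg one_le_two))
    linarith [Real.negMulLog_le_one_sub_self h0]
  · filter_upwards [tendsto_ae_condExp (μ := π) (ℱ := 𝓕) (A.indicator fun _ => (1 : ℝ))]
      with z hz
    exact ENNReal.tendsto_ofReal
      (((Real.continuous_negMulLog.tendsto _).comp hz).div_const _)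

/-- Conditional entropy is continuous along increasing sequences of `σ`-fields. -/
lemma tendsto_condEntropy [Countable Λ] (hF : Monotone F) (hFm : ∀ n, F n ≤ m)
    (hξ : partitionField ξ ≤ m) (hfin : condEntropy (F 0) π ξ ≠ ∞) :
    Tendsto (fun n => condEntropy (F n) π ξ) atTop (𝓝 (condEntropy (⨆ n, F n) π ξ)) := by
  have hsup : ⨆ n, F n ≤ m := iSup_le hFm
  -- The sum over blocks becomes an integral for counting measure, dominated by the summable block
  -- entropies given `F 0`.
  let : MeasurableSpace Λ := ⊤
  simp only [condEntropy_eq_tsum (hFm _) hξ, condEntropy_eq_tsum hsup hξ] at hfin ⊢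
  simp only [← lintegral_count] at hfin ⊢
  exact tendsto_lintegral_of_dominated_convergence _ (fun n => measurable_from_top)
    (fun n => ae_of_all _ fun l =>
      blockEntropy_anti (hF (Nat.zero_le n)) (hFm n) (measurableSet_block hξ l)) hfin
    (ae_of_all _ fun l => tendsto_blockEntropy hF hFm _)

lemma condEntropy_comap [Countable Λ] (hℱ : ℱ ≤ m) {T : Z → Z} (hT : MeasurePreserving T π π)
    (hξ : partitionField ξ ≤ m) :
    condEntropy (ℱ.comap T) π (ξ ∘ T) = condEntropy ℱ π ξ := by
  have h1 : ∀ᵐ z ∂π, ∀ l, condProb (ℱ.comap T) π (T ⁻¹' (ξ ⁻¹' {l})) z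
      = condProb ℱ π (ξ ⁻¹' {l}) (T z) :=
    ae_all_iff.2 fun l => condProb_comap hℱ hT (measurableSet_block hξ l)
  rw [condEntropy, condEntropy, ← hT.lintegral_comp (measurable_condInformation hℱ hξ)]
  refine lintegral_congr_ae ?_
  filter_upwards [h1] with z hz
  rw [condInformation_eq, condInformation_eq, ← hz]
  rfl

lemma condEntropy_congr_of_le [Countable Λ] (hℱ𝒢 : ℱ ≤ 𝒢) (h𝒢 : 𝒢 ≤ m) (h : SubsetMod 𝒢 ℱ π)
    (hξ : partitionField ξ ≤ m) : condEntropy ℱ π ξ = condEntropy 𝒢 π ξ := by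
  have h1 : ∀ᵐ z ∂π, ∀ l, condProb ℱ π (ξ ⁻¹' {l}) z = condProb 𝒢 π (ξ ⁻¹' {l}) z :=
    ae_all_iff.2 fun l => condProb_congr_of_le hℱ𝒢 h𝒢 h (measurableSet_block hξ l)
  refine lintegral_congr_ae ?_
  filter_upwards [h1] with z hz
  rw [condInformation_eq, condInformation_eq, ← hz]

lemma condEntropy_eq_zero_of_le [Countable Λ] (hℱ : ℱ ≤ m) (hξ : partitionField ξ ≤ ℱ) :
    condEntropy ℱ π ξ = 0 := by
  simp only [condEntropy, condInformation]
  refine (lintegral_congr fun z => ?_).trans lintegral_zero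
  have := condProb_of_measurableSet (π := π) hℱ (measurableSet_block hξ (ξ z))
  simp only [condProb] at this
  rw [this]
  simp

lemma measurableSet_of_condEntropy_eq_zero (hℱ : ℱ ≤ m)
    (hnull : ∀ s t, MeasurableSet[ℱ] t → s =ᵐ[π] t → MeasurableSet[ℱ] s)
    (hA : MeasurableSet A) (h : condEntropy ℱ π (fun z => z ∈ A) = 0) : MeasurableSet[ℱ] A := by
  have hξ : partitionField (fun z => z ∈ A) ≤ m :=
    partitionField_le_of_blocksIn fun p => by
      by_cases hp : p
      · convert hA; ext z; simp [hp]
      · convert hA.compl; ext z; simp [hp]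
  rw [condEntropy, lintegral_eq_zero_iff (measurable_condInformation hℱ hξ)] at h
  -- Zero information forces π(A|ℱ) ≥ 1 on `A`. The two sides have equal integrals, so the
  -- inequality is an equality almost everywhere.
  have hle : A.indicator (fun _ => (1 : ℝ)) ≤ᵐ[π] condProb ℱ π A := by
    filter_upwards [h, condProb_pos (π := π) hℱ hA, condProb_nonneg (π := π) (ℱ := ℱ) (A := A)]
      with z hz hpos h0
    by_cases hzA : z ∈ A
    · have hset : (fun z => z ∈ A) ⁻¹' {z ∈ A} = A := by ext w; simp [hzA]
      simp only [condInformation, hset, Pi.zero_apply, ENNReal.ofReal_eq_zero, neg_nonpos] at hz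
      rw [Set.indicator_of_mem hzA]
      by_contra hlt
      exact absurd hz (not_le.2 (Real.logb_neg one_lt_two (hpos hzA) (not_le.1 hlt)))
    · rwa [Set.indicator_of_notMem hzA]
  have heq : A.indicator (fun _ => (1 : ℝ)) =ᵐ[π] condProb ℱ π A :=
    (integral_eq_iff_of_ae_le (integrable_indicator_one hA) integrable_condExp hle).1
      (integral_condExp hℱ).symm
  have hS : MeasurableSet[ℱ] (condProb ℱ π A ⁻¹' {1}) :=
    measurable_condProb (measurableSet_singleton 1)
  refine hnull _ _ hS ?_
  filter_upwards [heq] with z hz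
  refine propext ?_
  change z ∈ A ↔ condProb ℱ π A z = 1
  rw [← hz]
  by_cases hzA : z ∈ A <;> simp [hzA]

end Entropy


/-! ### Symmetry and subadditivity -/

section ChainRuleConsequences

variable {ℱ : MeasurableSpace Z} [m : MeasurableSpace Z] {π : Measure Z}
  [IsProbabilityMeasure π] {ξ : Z → Λ} {η : Z → Λ'}

/-- Both sides are the entropy of the join. This is the symmetry of mutual information, written
without subtraction since entropies may be infinite. -/
lemma condEntropy_add_condEntropy_comm [Countable Λ] [Countable Λ'] (hℱ : ℱ ≤ m)
    (hξ : partitionField ξ ≤ m) (hη : partitionField η ≤ m) :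
    condEntropy ℱ π ξ + condEntropy (ℱ ⊔ partitionField ξ) π η =
      condEntropy ℱ π η + condEntropy (ℱ ⊔ partitionField η) π ξ := by
  rw [← condEntropy_prod hℱ hξ hη, ← condEntropy_prod hℱ hη hξ]
  exact condEntropy_congr_partition fun z w => by simp [and_comm]

lemma condEntropy_le_add [Countable Λ] [Countable Λ'] (hℱ : ℱ ≤ m)
    (hξ : partitionField ξ ≤ m) (hη : partitionField η ≤ m) :
    condEntropy ℱ π η ≤ condEntropy ℱ π ξ + condEntropy (ℱ ⊔ partitionField ξ) π η := by
  rw [condEntropy_add_condEntropy_comm hℱ hξ hη]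
  exact le_self_add

lemma condEntropy_ne_top_of_finite [Finite Λ] (hℱ : ℱ ≤ m) (hξ : partitionField ξ ≤ m) :
    condEntropy ℱ π ξ ≠ ∞ := by
  have := Fintype.ofFinite Λ
  rw [condEntropy_eq_tsum hℱ hξ, tsum_fintype]
  refine ENNReal.sum_ne_top.2 fun l _ => ?_
  rw [blockEntropy_eq_ofReal_integral hℱ (measurableSet_block hξ l)]
  exact ENNReal.ofReal_ne_top

end ChainRuleConsequences

/-! ### Itineraries -/

section Itineraries

variable {T : Z → Z} {ξ : Z → Λ}

lemma itinerary_succ_eq_iff_cons (n : ℕ) (z w : Z) :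
    itinerary T ξ (n + 1) z = itinerary T ξ (n + 1) w ↔
      ((itinerary T ξ n ∘ T) z, ξ z) = ((itinerary T ξ n ∘ T) w, ξ w) := by
  simp only [funext_iff, itinerary, Prod.mk.injEq, Function.comp_apply, Fin.forall_fin_succ,
    Fin.val_zero, Fin.val_succ, Function.iterate_zero, id, Function.iterate_succ_apply]
  exact and_comm

lemma itinerary_succ_iterate_eq_iff_snoc (q n : ℕ) (z w : Z) :
    (itinerary T ξ (n + 1) ∘ T^[q]) z = (itinerary T ξ (n + 1) ∘ T^[q]) w ↔
      ((ξ ∘ T^[q + n]) z, (itinerary T ξ n ∘ T^[q]) z) =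
        ((ξ ∘ T^[q + n]) w, (itinerary T ξ n ∘ T^[q]) w) := by
  simp only [funext_iff, itinerary, Prod.mk.injEq, Function.comp_apply, Fin.forall_fin_succ',
    Fin.val_castSucc, Fin.val_last, ← Function.iterate_add_apply, Nat.add_comm q n]
  exact and_comm

lemma partitionField_iterate_le_itinerary {k n : ℕ} (hk : k < n) :
    partitionField (ξ ∘ T^[k]) ≤ partitionField (itinerary T ξ n) := by
  rintro _ ⟨S, -, rfl⟩
  exact ⟨{f | f ⟨k, hk⟩ ∈ S}, trivial, rfl⟩

lemma partitionField_itinerary_le [Countable Λ] {ℱ : MeasurableSpace Z} {n : ℕ}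
    (h : ∀ k < n, partitionField (ξ ∘ T^[k]) ≤ ℱ) : partitionField (itinerary T ξ n) ≤ ℱ := by
  refine partitionField_le_of_blocksIn fun f => ?_
  have : itinerary T ξ n ⁻¹' {f} = ⋂ k : Fin n, (ξ ∘ T^[k]) ⁻¹' {f k} := by
    ext z
    simp [funext_iff, itinerary]
  rw [this]
  exact MeasurableSet.iInter fun k => measurableSet_block (h k k.2) _

lemma partitionField_itinerary_mono [Countable Λ] :
    Monotone fun n => partitionField (itinerary T ξ n) := fun _ _ h =>
  partitionField_itinerary_le fun _ hk =>
    partitionField_iterate_le_itinerary (hk.trans_le h)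

lemma partitionField_iterate_le [m : MeasurableSpace Z] (hT : Measurable T)
    (hξ : partitionField ξ ≤ m) (k : ℕ) : partitionField (ξ ∘ T^[k]) ≤ m := by
  rw [← partitionField_comap]
  exact (MeasurableSpace.comap_mono hξ).trans (hT.iterate k).comap_le

lemma partitionField_itinerary_le_of_measurable [Countable Λ] [m : MeasurableSpace Z]
    (hT : Measurable T) (hξ : partitionField ξ ≤ m) (n : ℕ) :
    partitionField (itinerary T ξ n) ≤ m :=
  partitionField_itinerary_le fun k _ => partitionField_iterate_le hT hξ k

end Itineraries

/-! ### The decreasing fields F_q and stationarity -/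

section Future

/-- The `σ`-field `ℬ ∨ ⋁_{k ≥ q} T⁻ᵏγ`. -/
def futureField (ℬ : MeasurableSpace Z) (T : Z → Z) (γ : Z → Λ) (q : ℕ) : MeasurableSpace Z :=
  ℬ ⊔ ⨆ (k : ℕ) (_ : q ≤ k), partitionField (γ ∘ T^[k])

variable {ℬ 𝒢 : MeasurableSpace Z} {T : Z → Z} {γ : Z → Λ}

lemma le_futureField (q : ℕ) : ℬ ≤ futureField ℬ T γ q := le_sup_left

lemma partitionField_le_futureField {q k : ℕ} (h : q ≤ k) :
    partitionField (γ ∘ T^[k]) ≤ futureField ℬ T γ q :=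
  le_sup_of_le_right
    (le_iSup₂_of_le (f := fun k (_ : q ≤ k) => partitionField (γ ∘ T^[k])) k h le_rfl)

lemma futureField_le {ℱ : MeasurableSpace Z} {q : ℕ} (hℬ : ℬ ≤ ℱ)
    (h : ∀ k, q ≤ k → partitionField (γ ∘ T^[k]) ≤ ℱ) : futureField ℬ T γ q ≤ ℱ :=
  sup_le hℬ (iSup₂_le h)

lemma futureField_antitone : Antitone (futureField ℬ T γ) := fun _ _ h =>
  futureField_le (le_futureField _) fun _ hk => partitionField_le_futureField (h.trans hk)

lemma futureField_succ_sup (q : ℕ) :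
    futureField ℬ T γ (q + 1) ⊔ partitionField (γ ∘ T^[q]) = futureField ℬ T γ q := by
  refine le_antisymm (sup_le (futureField_antitone q.le_succ)
    (partitionField_le_futureField le_rfl)) ?_
  refine futureField_le (le_sup_of_le_left (le_futureField _)) fun k hk => ?_
  rcases hk.eq_or_lt with rfl | hk
  · exact le_sup_right
  · exact le_sup_of_le_left (partitionField_le_futureField hk)

lemma comap_futureField (hℬ : ℬ.comap T = ℬ) (q : ℕ) :
    (futureField ℬ T γ q).comap T = futureField ℬ T γ (q + 1) := by
  have hk : ∀ k, (partitionField (γ ∘ T^[k])).comap T = partitionField (γ ∘ T^[k + 1]) :=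
    fun k => by rw [partitionField_comap, Function.iterate_succ, Function.comp_assoc]
  refine le_antisymm ?_ (futureField_le ?_ ?_)
  · rw [futureField, MeasurableSpace.comap_sup, hℬ]
    simp only [MeasurableSpace.comap_iSup, hk]
    exact sup_le (le_futureField _)
      (iSup₂_le fun k h => partitionField_le_futureField (Nat.succ_le_succ h))
  · exact hℬ.symm.le.trans (MeasurableSpace.comap_mono (le_futureField q))
  · rintro (_ | k) h
    · exact absurd h (by simp)
    · rw [← hk]
      exact MeasurableSpace.comap_mono (partitionField_le_futureField (Nat.le_of_succ_le_succ h))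

lemma comap_iterate_futureField (hℬ : ℬ.comap T = ℬ) (q n : ℕ) :
    (futureField ℬ T γ q).comap T^[n] = futureField ℬ T γ (q + n) := by
  induction n with
  | zero => simp [MeasurableSpace.comap_id]
  | succ n ih =>
    rw [Function.iterate_succ, ← MeasurableSpace.comap_comp, ih, comap_futureField hℬ]
    rfl

variable [m : MeasurableSpace Z] {π : Measure Z} [IsProbabilityMeasure π] [Countable Λ]

lemma futureField_le_of_measurable (hℬm : ℬ ≤ m) (hT : Measurable T)
    (hγ : partitionField γ ≤ m) (q : ℕ) : futureField ℬ T γ q ≤ m :=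
  futureField_le hℬm fun k _ => partitionField_iterate_le hT hγ k

lemma condEntropy_futureField (hℬm : ℬ ≤ m) (hT : MeasurePreserving T π π)
    (hγ : partitionField γ ≤ m) (hℬ : ℬ.comap T = ℬ) [Countable Λ'] {ξ : Z → Λ'}
    (hξ : partitionField ξ ≤ m) (q n : ℕ) :
    condEntropy (futureField ℬ T γ (q + n)) π (ξ ∘ T^[n]) =
      condEntropy (futureField ℬ T γ q) π ξ := by
  rw [← comap_iterate_futureField hℬ, condEntropy_comap
    (futureField_le_of_measurable hℬm hT.measurable hγ q) (hT.iterate n) hξ]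

/-- The latest coordinate is split off first: adjoining it to the conditioning field turns F_{q+n+1}
into F_{q+n}, exactly the field of the induction hypothesis. The extra field `𝒢` is carried along to
hold an α-itinerary. -/
lemma condEntropy_itinerary_eq_sum (hℬm : ℬ ≤ m) (h𝒢 : 𝒢 ≤ m)
    (hT : Measurable T) (hγ : partitionField γ ≤ m) (q n : ℕ) :
    condEntropy (futureField ℬ T γ (q + n) ⊔ 𝒢) π (itinerary T γ n ∘ T^[q]) =
      ∑ k ∈ Finset.range n,
        condEntropy (futureField ℬ T γ (q + k + 1) ⊔ 𝒢) π (γ ∘ T^[q + k]) := by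
  have hF : ∀ q, futureField ℬ T γ q ⊔ 𝒢 ≤ m := fun q =>
    sup_le (futureField_le_of_measurable hℬm hT hγ q) h𝒢
  have hI : ∀ n, partitionField (itinerary T γ n ∘ T^[q]) ≤ m := fun n =>
    partitionField_iterate_le hT (partitionField_itinerary_le_of_measurable hT hγ n) q
  induction n with
  | zero =>
    rw [Finset.sum_range_zero]
    refine condEntropy_eq_zero_of_le (hF _) ?_
    refine partitionField_le_of_blocksIn (ξ := itinerary T γ 0 ∘ T^[q]) fun f => ?_
    convert MeasurableSet.univ
    ext z
    simpa using Subsingleton.elim _ _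
  | succ n ih =>
    rw [condEntropy_congr_partition (itinerary_succ_iterate_eq_iff_snoc q n),
      condEntropy_prod (hF _) (partitionField_iterate_le hT hγ _) (hI n),
      Finset.sum_range_succ, ← ih, add_comm, ← add_assoc q n 1, sup_right_comm,
      futureField_succ_sup]

end Future


/-! ### Zero relative entropy rate versus measurability in every F_q -/

section RelativePinsker

variable {ℬ : MeasurableSpace Z} {γ : Z → Λ} {α : Z → Λ'} [m : MeasurableSpace Z]
  {π : Measure Z} [IsProbabilityMeasure π] [Countable Λ] [Countable Λ']

lemma condEntropy_ne_top_of_entropy (hℬm : ℬ ≤ m) (hγ : partitionField γ ≤ m)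
    (hγent : entropy π γ ≠ ∞) : condEntropy ℬ π γ ≠ ∞ :=
  ne_top_of_le_ne_top hγent (condEntropy_anti bot_le hℬm hγ)

lemma condEntropy_itinerary_futureField {T : Z → Z} (hℬm : ℬ ≤ m) (hT : MeasurePreserving T π π)
    (hγ : partitionField γ ≤ m) (hℬ : ℬ.comap T = ℬ) (q n : ℕ) :
    condEntropy (futureField ℬ T γ (q + n)) π (itinerary T γ n ∘ T^[q]) =
      n * condEntropy (futureField ℬ T γ 1) π γ := by
  have h := condEntropy_itinerary_eq_sum (π := π) hℬm bot_le hT.measurable hγ q n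
  simp only [sup_bot_eq] at h
  rw [h, Finset.sum_congr rfl fun k _ => by
    rw [Nat.add_comm (q + k) 1, condEntropy_futureField hℬm hT hγ hℬ hγ 1 (q + k)]]
  simp

/-- If `α` has vanishing entropy rate given `ℬ`, then it carries no information on the present of
`γ` once `ℬ` and the future of `γ` are known. -/
lemma condEntropy_sup_eq_of_rate_zero {T : Z → Z} (hℬm : ℬ ≤ m) (hT : MeasurePreserving T π π)
    (hγ : partitionField γ ≤ m) (hα : partitionField α ≤ m) (hℬ : ℬ.comap T = ℬ)
    (h0 : Tendsto (fun n : ℕ => condEntropy ℬ π (itinerary T α n) / n) atTop (𝓝 0)) (p q : ℕ) :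
    condEntropy (futureField ℬ T γ (q + 1) ⊔ partitionField (α ∘ T^[p])) π (γ ∘ T^[q]) =
      condEntropy (futureField ℬ T γ 1) π γ := by
  have hF := futureField_le_of_measurable hℬm hT.measurable hγ
  have hαp := partitionField_iterate_le hT.measurable hα
  have hγq := partitionField_iterate_le hT.measurable hγ
  have hαI := partitionField_itinerary_le_of_measurable hT.measurable hα
  have hγI : ∀ n, partitionField (itinerary T γ n ∘ T^[q]) ≤ m := fun n =>
    partitionField_iterate_le hT.measurable
      (partitionField_itinerary_le_of_measurable hT.measurable hγ n) q
  set c := condEntropy (futureField ℬ T γ 1) π γ with hc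
  set d := condEntropy (futureField ℬ T γ (q + 1) ⊔ partitionField (α ∘ T^[p])) π (γ ∘ T^[q])
    with hd
  refine le_antisymm ?_ ?_
  · rw [hd, hc, ← condEntropy_futureField hℬm hT hγ hℬ hγ 1 q, Nat.add_comm 1 q]
    exact condEntropy_anti le_sup_left (sup_le (hF _) (hαp p)) (hγq q)
  -- Length `n + p` makes the α-itinerary contain α ∘ T^(p+k) for every k < n, so the k-th summand
  -- is bounded by the shift of `d` by `T^[k]`.
  have key : ∀ n : ℕ, n * c ≤ condEntropy ℬ π (itinerary T α (n + p)) + n * d := by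
    intro n
    rw [hc, ← condEntropy_itinerary_futureField hℬm hT hγ hℬ q n]
    refine (condEntropy_le_add (hF _) (hαI (n + p)) (hγI n)).trans (add_le_add ?_ ?_)
    · exact condEntropy_anti (le_futureField _) (hF _) (hαI _)
    rw [condEntropy_itinerary_eq_sum hℬm (hαI (n + p)) hT.measurable hγ]
    refine (Finset.sum_le_card_nsmul _ _ d fun k hk => ?_).trans (by simp)
    have hkn : p + k < n + p := by have := Finset.mem_range.1 hk; omega
    have hle : futureField ℬ T γ (q + k + 1) ⊔ partitionField (α ∘ T^[p + k]) ≤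
        futureField ℬ T γ (q + k + 1) ⊔ partitionField (itinerary T α (n + p)) :=
      sup_le_sup_left (partitionField_iterate_le_itinerary hkn) _
    refine (condEntropy_anti hle (sup_le (hF _) (hαI _)) (hγq _)).trans_eq ?_
    have e1 : futureField ℬ T γ (q + k + 1) ⊔ partitionField (α ∘ T^[p + k]) =
        (futureField ℬ T γ (q + 1) ⊔ partitionField (α ∘ T^[p])).comap T^[k] := by
      rw [MeasurableSpace.comap_sup, comap_iterate_futureField hℬ, partitionField_comap,
        Function.comp_assoc, ← Function.iterate_add, Nat.add_right_comm]
    rw [e1, Function.iterate_add T q k, ← Function.comp_assoc,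
      condEntropy_comap (sup_le (hF _) (hαp _)) (hT.iterate k) (hγq _)]
  -- The factor `1 + p` compensates for dividing by `n + p` instead of `n`: for n ≥ 1, n + p ≤ n(1 +
  -- p).
  have hlim : Tendsto (fun n : ℕ =>
      condEntropy ℬ π (itinerary T α (n + p)) / ((n + p : ℕ) : ℝ≥0∞) * (1 + p) + d)
      atTop (𝓝 d) := by
    have h1 := ENNReal.Tendsto.mul_const (b := (1 + p : ℝ≥0∞)) (h0.comp (tendsto_add_atTop_nat p))
      (Or.inr (by simp))
    simpa using h1.add (tendsto_const_nhds (x := d))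
  refine ge_of_tendsto hlim ?_
  filter_upwards [eventually_ge_atTop 1] with n hn
  have hn0 : (n : ℝ≥0∞) ≠ 0 := by positivity
  have hnp0 : ((n + p : ℕ) : ℝ≥0∞) ≠ 0 := by
    have : n + p ≠ 0 := by omega
    exact_mod_cast this
  refine (ENNReal.mul_le_mul_iff_right hn0 (ENNReal.natCast_ne_top n)).1 ?_
  refine (key n).trans ?_
  rw [mul_add]
  gcongr
  set a := condEntropy ℬ π (itinerary T α (n + p))
  calc a = a / ((n + p : ℕ) : ℝ≥0∞) * ((n + p : ℕ) : ℝ≥0∞) :=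
        (ENNReal.div_mul_cancel hnp0 (ENNReal.natCast_ne_top _)).symm
    _ ≤ a / ((n + p : ℕ) : ℝ≥0∞) * (n * (1 + p)) := by
        gcongr
        have : n + p ≤ n * (1 + p) := by nlinarith
        exact_mod_cast this
    _ = n * (a / ((n + p : ℕ) : ℝ≥0∞) * (1 + p)) := by ring

/-- Vanishing entropy rate given `ℬ` implies measurability in the future of a generator. -/
lemma condEntropy_futureField_eq_zero_of_rate_zero {T : Z ≃ᵐ Z} [Finite Λ'] (hℬm : ℬ ≤ m)
    (hT : MeasurePreserving T π π) (hγ : partitionField γ ≤ m) (hα : partitionField α ≤ m)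
    (hℬ : ℬ.comap T = ℬ) (hγent : entropy π γ ≠ ∞)
    (hgen : ⨆ p : ℕ, (futureField ℬ T γ 0).comap T.symm^[p] = m)
    (h0 : Tendsto (fun n : ℕ => condEntropy ℬ π (itinerary T α n) / n) atTop (𝓝 0)) (q : ℕ) :
    condEntropy (futureField ℬ T γ q) π α = 0 := by
  have hF := futureField_le_of_measurable hℬm hT.measurable hγ
  have hαp := partitionField_iterate_le hT.measurable hα
  have hγq := partitionField_iterate_le hT.measurable hγ
  have hc : condEntropy (futureField ℬ T γ 1) π γ ≠ ∞ :=
    condEntropy_ne_top_of_entropy (hF 1) hγ hγent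
  -- In the symmetric chain rule for T^{-q}γ and T⁻ᵖα over F_{q+1}, both γ-terms equal `c`, and
  -- finiteness of `c` allows cancelling them.
  have step : ∀ p q, condEntropy (futureField ℬ T γ q) π (α ∘ T^[p]) =
      condEntropy (futureField ℬ T γ (q + 1)) π (α ∘ T^[p]) := by
    intro p q
    have h := condEntropy_add_condEntropy_comm (π := π) (hF (q + 1)) (hγq q) (hαp p)
    rw [condEntropy_sup_eq_of_rate_zero hℬm hT hγ hα hℬ h0, futureField_succ_sup,
      Nat.add_comm q 1, condEntropy_futureField hℬm hT hγ hℬ hγ 1 q, add_comm] at h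
    rw [Nat.add_comm q 1]
    exact (ENNReal.add_left_inj hc).1 h
  have const : ∀ p q, condEntropy (futureField ℬ T γ q) π (α ∘ T^[p]) =
      condEntropy (futureField ℬ T γ 0) π (α ∘ T^[p]) := by
    intro p q
    induction q with
    | zero => rfl
    | succ q ih => rw [← step, ih]
  have hS : MeasurePreserving T.symm π π := hT.symm T
  have hinv : ∀ p, T.symm^[p] ∘ T^[p] = id := fun p =>
    funext (Function.LeftInverse.iterate T.symm_apply_apply p)
  have hGm : ∀ p : ℕ, (futureField ℬ T γ 0).comap T.symm^[p] ≤ m := fun p =>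
    (MeasurableSpace.comap_mono (hF 0)).trans (hS.iterate p).measurable.comap_le
  -- Moving by `T^[p]` turns the left side into H(T⁻ᵖα|F_0), which `const` equates with
  -- H(T⁻ᵖα|F_{q+p}), that is, H(α|F_q).
  have hG : ∀ p : ℕ, condEntropy ((futureField ℬ T γ 0).comap T.symm^[p]) π α =
      condEntropy (futureField ℬ T γ q) π α := by
    intro p
    rw [← condEntropy_comap (hGm p) (hT.iterate p) hα, MeasurableSpace.comap_comp, hinv,
      MeasurableSpace.comap_id, ← const p (q + p), condEntropy_futureField hℬm hT hγ hℬ hα]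
  have hmono : Monotone fun p : ℕ => (futureField ℬ T γ 0).comap T.symm^[p] := by
    refine monotone_nat_of_le_succ fun p => ?_
    have h1 : futureField ℬ T γ 0 ≤ (futureField ℬ T γ 0).comap T.symm := by
      have h2 := MeasurableSpace.comap_mono (g := T.symm)
        (futureField_antitone (ℬ := ℬ) (T := T) (γ := γ) (Nat.zero_le 1))
      rw [← comap_futureField hℬ 0, MeasurableSpace.comap_comp] at h2
      have h3 : T ∘ T.symm = id := funext T.apply_symm_apply
      rwa [h3, MeasurableSpace.comap_id] at h2
    rw [Function.iterate_succ', ← MeasurableSpace.comap_comp]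
    exact MeasurableSpace.comap_mono h1
  have hlim := tendsto_condEntropy (π := π) hmono hGm hα
    (condEntropy_ne_top_of_finite (hGm 0) hα)
  simp only [hG] at hlim
  rw [hgen, condEntropy_eq_zero_of_le le_rfl hα] at hlim
  exact tendsto_nhds_unique tendsto_const_nhds hlim

/-- If `u` has increments at most `v n → c` and `a n + n c ≤ u n`, then `a n / n → 0`. -/
lemma limsup_div_eq_zero_of_increments {a u v : ℕ → ℝ≥0∞} {c : ℝ≥0∞} (hc : c ≠ ∞)
    (hu0 : u 0 ≠ ∞) (hv : ∀ n, v n ≠ ∞) (hvc : Tendsto v atTop (𝓝 c))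
    (hu : ∀ n, u (n + 1) ≤ u n + v n) (ha : ∀ n : ℕ, a n + n * c ≤ u n) :
    limsup (fun n : ℕ => a n / n) atTop = 0 := by
  have hufin : ∀ n, u n ≠ ∞ := by
    intro n
    induction n with
    | zero => exact hu0
    | succ n ih => exact ne_top_of_le_ne_top (ENNReal.add_ne_top.2 ⟨ih, hv n⟩) (hu n)
  refine le_antisymm (ENNReal.le_of_forall_pos_le_add fun δ hδ _ => ?_) bot_le
  rw [zero_add]
  have hδ' : (δ : ℝ≥0∞) ≠ 0 := by exact_mod_cast hδ.ne'
  obtain ⟨N, hN⟩ := eventually_atTop.1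
    (hvc.eventually (gt_mem_nhds (ENNReal.lt_add_right hc hδ')))
  -- From `N` on the increments are below c + δ; after cancelling n·c only u_N + n·δ remains to
  -- bound a_n.
  have hbound : ∀ k : ℕ, u (N + k) ≤ u N + k * (c + δ) := by
    intro k
    induction k with
    | zero => simp
    | succ k ih =>
      refine (hu (N + k)).trans ((add_le_add ih (hN (N + k) (Nat.le_add_right _ _)).le).trans_eq ?_)
      push_cast
      ring
  have hlim : Tendsto (fun n : ℕ => u N / n + δ) atTop (𝓝 δ) := by
    have h1 := (ENNReal.Tendsto.const_div (a := u N) ENNReal.tendsto_nat_nhds_top (Or.inr (hufin N))).add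
      (tendsto_const_nhds (x := (δ : ℝ≥0∞)))
    rwa [ENNReal.div_top, zero_add] at h1
  refine (limsup_le_limsup ?_).trans_eq hlim.limsup_eq
  filter_upwards [eventually_ge_atTop (max N 1)] with n hn
  have hn0 : (n : ℝ≥0∞) ≠ 0 := by
    have : n ≠ 0 := by have := le_of_max_le_right hn; omega
    exact_mod_cast this
  have hnt : (n : ℝ≥0∞) ≠ ∞ := ENNReal.natCast_ne_top n
  obtain ⟨k, rfl⟩ := Nat.exists_eq_add_of_le (le_of_max_le_left hn)
  have h1 : a (N + k) + ((N + k : ℕ) : ℝ≥0∞) * c ≤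
      (u N + ((N + k : ℕ) : ℝ≥0∞) * δ) + ((N + k : ℕ) : ℝ≥0∞) * c := by
    refine (ha _).trans ((hbound k).trans ?_)
    rw [mul_add, add_assoc, add_comm (((N + k : ℕ) : ℝ≥0∞) * δ)]
    gcongr <;> simp
  have h2 := (ENNReal.add_le_add_iff_right (ENNReal.mul_ne_top hnt hc)).1 h1
  rw [ENNReal.div_le_iff hn0 hnt, add_mul, ENNReal.div_mul_cancel hn0 hnt, mul_comm (δ : ℝ≥0∞)]
  exact h2

/-- A partition measurable in every future of `γ` has vanishing entropy rate given `ℬ`. -/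
lemma limsup_condEntropy_eq_zero_of_le_futureField {T : Z → Z} [Finite Λ'] (hℬm : ℬ ≤ m)
    (hT : MeasurePreserving T π π) (hγ : partitionField γ ≤ m) (hα : partitionField α ≤ m)
    (hℬ : ℬ.comap T = ℬ) (hγent : entropy π γ ≠ ∞)
    (h : ∀ q, partitionField α ≤ futureField ℬ T γ q) :
    limsup (fun n : ℕ => condEntropy ℬ π (itinerary T α n) / n) atTop = 0 := by
  have hF := futureField_le_of_measurable hℬm hT.measurable hγ
  have hαI := partitionField_itinerary_le_of_measurable hT.measurable hα
  have hγI := partitionField_itinerary_le_of_measurable hT.measurable hγ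
  -- T⁻ᵏα lies in F_{q+k}, hence in F_q.
  have hαIF : ∀ n q, partitionField (itinerary T α n) ≤ futureField ℬ T γ q := fun n q =>
    partitionField_itinerary_le fun k _ => by
      rw [← partitionField_comap]
      refine (MeasurableSpace.comap_mono (h q)).trans ?_
      rw [comap_iterate_futureField hℬ]
      exact futureField_antitone (Nat.le_add_right q k)
  set c := condEntropy (futureField ℬ T γ 1) π γ with hcdef
  set E : ℕ → MeasurableSpace Z := fun n => ℬ ⊔ partitionField (itinerary T γ n) with hE
  have hEm : ∀ n, E n ≤ m := fun n => sup_le hℬm (hγI n)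
  have hEmono : Monotone E := fun _ _ hn =>
    sup_le_sup_left (partitionField_itinerary_mono hn) _
  have hEcomap : ∀ n, (E n).comap T = ℬ ⊔ partitionField (itinerary T γ n ∘ T) := fun n => by
    rw [hE, MeasurableSpace.comap_sup, hℬ, partitionField_comap]
  have hEsup : ⨆ n, E n = futureField ℬ T γ 0 := by
    refine le_antisymm (iSup_le fun n => sup_le (le_futureField 0)
      (partitionField_itinerary_le fun k _ => partitionField_le_futureField (Nat.zero_le k))) ?_
    exact futureField_le (le_iSup_of_le 0 le_sup_left) fun k _ =>
      le_iSup_of_le (k + 1) (le_sup_of_le_right (partitionField_iterate_le_itinerary k.lt_succ_self))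
  have hDm : ∀ n, (E n).comap T ≤ m := fun n =>
    (MeasurableSpace.comap_mono (hEm n)).trans hT.measurable.comap_le
  have hDsup : ⨆ n, (E n).comap T = futureField ℬ T γ 1 := by
    rw [← MeasurableSpace.comap_iSup, hEsup, comap_futureField hℬ]
  have hDlim : Tendsto (fun n => condEntropy ((E n).comap T) π γ) atTop (𝓝 c) := by
    have := tendsto_condEntropy (π := π) (fun _ _ hn => MeasurableSpace.comap_mono (hEmono hn))
      hDm hγ (condEntropy_ne_top_of_entropy (hDm 0) hγ hγent)
    rwa [hDsup] at this
  have hElim : Tendsto (fun n => condEntropy (E n) π α) atTop (𝓝 0) := by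
    have := tendsto_condEntropy (π := π) hEmono hEm hα (condEntropy_ne_top_of_finite (hEm 0) hα)
    rwa [hEsup, condEntropy_eq_zero_of_le (hF 0) (h 0)] at this
  have hγIT : ∀ n, partitionField (itinerary T γ n ∘ T) ≤ m := fun n =>
    partitionField_iterate_le hT.measurable (hγI n) 1
  have hαIT : ∀ n, partitionField (itinerary T α n ∘ T) ≤ m := fun n =>
    partitionField_iterate_le hT.measurable (hαI n) 1
  -- Here `u n` is the entropy given `ℬ` of γⁿ joined with αⁿ. The two terms of `v` tend to `c` and
  -- to 0, because `E n` increases to F_0, which contains α, and its preimage increases to F_1.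
  refine limsup_div_eq_zero_of_increments (c := c)
    (u := fun n => condEntropy ℬ π (itinerary T γ n) + condEntropy (E n) π (itinerary T α n))
    (v := fun n => condEntropy ((E n).comap T) π γ + condEntropy (E (n + 1)) π α)
    (condEntropy_ne_top_of_entropy (hF 1) hγ hγent) ?_ ?_ ?_ ?_ ?_
  · exact ENNReal.add_ne_top.2 ⟨condEntropy_ne_top_of_finite hℬm (hγI 0),
      condEntropy_ne_top_of_finite (hEm 0) (hαI 0)⟩
  · exact fun n => ENNReal.add_ne_top.2
      ⟨condEntropy_ne_top_of_entropy (hDm n) hγ hγent, condEntropy_ne_top_of_finite (hEm _) hα⟩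
  · simpa using hDlim.add (hElim.comp (tendsto_add_atTop_nat 1))
  · intro n
    have h1 : condEntropy ℬ π (itinerary T γ (n + 1)) =
        condEntropy ℬ π (itinerary T γ n) + condEntropy ((E n).comap T) π γ := by
      rw [condEntropy_congr_partition (itinerary_succ_eq_iff_cons n),
        condEntropy_prod hℬm (hγIT n) hγ, ← hEcomap]
      congr 1
      conv_lhs => rw [← hℬ]
      exact condEntropy_comap hℬm hT (hγI n)
    have h2 : condEntropy (E (n + 1)) π (itinerary T α (n + 1)) ≤
        condEntropy (E n) π (itinerary T α n) + condEntropy (E (n + 1)) π α := by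
      rw [condEntropy_congr_partition (itinerary_succ_eq_iff_cons n),
        condEntropy_prod (hEm _) (hαIT n) hα]
      refine add_le_add ?_ (condEntropy_anti le_sup_left (sup_le (hEm _) (hαIT n)) hα)
      rw [← condEntropy_comap (hEm n) hT (hαI n)]
      refine condEntropy_anti ?_ (hEm _) (hαIT n)
      rw [hEcomap, hE]
      refine sup_le_sup_left ?_ _
      have h3 : partitionField (itinerary T γ (n + 1)) =
          partitionField (itinerary T γ n ∘ T) ⊔ partitionField γ := by
        rw [← partitionField_prod]
        exact partitionField_congr (itinerary_succ_eq_iff_cons n)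
      rw [h3]
      exact le_sup_left
    calc _ ≤ (condEntropy ℬ π (itinerary T γ n) + condEntropy ((E n).comap T) π γ) +
          (condEntropy (E n) π (itinerary T α n) + condEntropy (E (n + 1)) π α) :=
          add_le_add h1.le h2
      _ = _ := by ring
  · intro n
    have h1 := condEntropy_itinerary_futureField hℬm hT hγ hℬ 0 n
    rw [Function.iterate_zero, Function.comp_id, zero_add] at h1
    -- Splitting the join in the other order leaves H(γⁿ|ℬ ∨ αⁿ), which is at least H(γⁿ|F_n) = n·c
    -- because F_n contains `ℬ` and αⁿ.
    rw [← h1, condEntropy_add_condEntropy_comm hℬm (hγI n) (hαI n)]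
    gcongr
    exact condEntropy_anti (sup_le (le_futureField n) (hαIF n n)) (hF n) (hγI n)

end RelativePinsker


/-! ### Completions and null sets -/

section Completion

variable {ℬ 𝒢 : MeasurableSpace Z} [m : MeasurableSpace Z] {π : Measure Z}

lemma completionField_le (hπ : π.IsComplete) (hℬ : ℬ ≤ m) : completionField ℬ π ≤ m := by
  rintro s ⟨t, ht, hst⟩
  exact (NullMeasurableSet.congr (hℬ _ ht).nullMeasurableSet hst.symm).measurable_of_complete

lemma completionField_mono (h : ℬ ≤ 𝒢) : completionField ℬ π ≤ completionField 𝒢 π := by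
  rintro s ⟨t, ht, hst⟩
  exact ⟨t, h _ ht, hst⟩

lemma measurableSet_congr_of_completionField_le (h : completionField ℬ π ≤ 𝒢) {s t : Set Z}
    (ht : MeasurableSet[𝒢] t) (hst : s =ᵐ[π] t) : MeasurableSet[𝒢] s := by
  have hnull : ∀ N, π N = 0 → MeasurableSet[𝒢] N := fun N hN =>
    h _ ⟨∅, @MeasurableSet.empty _ ℬ, ae_eq_empty.2 hN⟩
  have e : s = (t \ (t \ s)) ∪ (s \ t) := by
    ext z; by_cases z ∈ s <;> by_cases z ∈ t <;> simp_all
  rw [e]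
  exact (ht.diff (hnull _ (ae_le_set.1 hst.symm.le))).union (hnull _ (ae_le_set.1 hst.le))

lemma subsetMod_completionField : SubsetMod (completionField ℬ π) ℬ π := by
  rintro s ⟨t, ht, hst⟩
  exact ⟨t, ht, measure_symmDiff_eq_zero_iff.2 hst⟩

/-- Invariance modulo null sets becomes an equality of σ-fields, as the shift identities for F_q
require. -/
lemma comap_completionField {T : Z ≃ᵐ Z} (hT : MeasurePreserving T π π) (hℬ : IsFactor ℬ π T) :
    (completionField ℬ π).comap T = completionField ℬ π := by
  refine le_antisymm ?_ ?_
  · rintro _ ⟨s, ⟨t, ht, hst⟩, rfl⟩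
    obtain ⟨u, hu, htu⟩ := hℬ.preimage.1 (T ⁻¹' t) ⟨t, ht, rfl⟩
    exact ⟨u, hu, (hT.quasiMeasurePreserving.preimage_ae_eq hst).trans
      (measure_symmDiff_eq_zero_iff.1 htu)⟩
  · rintro s ⟨t, ht, hst⟩
    obtain ⟨_, ⟨u, hu, rfl⟩, htu⟩ := hℬ.preimage.2 t ht
    have hS : MeasurePreserving T.symm π π := hT.symm T
    refine ⟨T.symm ⁻¹' s, ⟨u, hu, ?_⟩, ?_⟩
    · have h1 := hS.quasiMeasurePreserving.preimage_ae_eq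
        (hst.trans (measure_symmDiff_eq_zero_iff.1 htu))
      rwa [← Set.preimage_comp, show ⇑T ∘ ⇑T.symm = id from funext T.apply_symm_apply,
        Set.preimage_id] at h1
    · rw [← Set.preimage_comp, show ⇑T.symm ∘ ⇑T = id from funext T.symm_apply_apply,
        Set.preimage_id]

/-- For a decreasing sequence of `σ`-fields, the completion of the intersection is the
intersection of the completions. -/
lemma measurableSet_completionField_iInf_iff {F : ℕ → MeasurableSpace Z} (hF : Antitone F)
    {A : Set Z} : MeasurableSet[completionField (⨅ n, F n) π] A ↔
      ∀ n, MeasurableSet[completionField (F n) π] A := by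
  refine ⟨fun h n => completionField_mono (iInf_le F n) _ h, fun h => ?_⟩
  choose t ht hAt using h
  -- The limsup of the approximating sets ignores any finite number of them, so it lies in every `F
  -- N`.
  refine ⟨⋂ n, ⋃ k, t (n + k), ?_, ?_⟩
  · rw [MeasurableSpace.measurableSet_iInf]
    intro N
    have hanti : Antitone fun n => ⋃ k, t (n + k) := by
      refine antitone_nat_of_succ_le fun n => Set.iUnion_subset fun k => ?_
      exact Set.subset_iUnion_of_subset (k + 1) (by rw [Nat.add_right_comm, Nat.add_assoc])
    rw [← hanti.iInter_nat_add N]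
    exact MeasurableSet.iInter fun n => MeasurableSet.iUnion fun k =>
      hF ((Nat.le_add_left N n).trans (Nat.le_add_right _ k)) _ (ht _)
  · have h1 : (⋂ _ : ℕ, ⋃ _ : ℕ, A : Set Z) =ᵐ[π] ⋂ n, ⋃ k, t (n + k) :=
      Filter.EventuallyEq.countable_iInter fun n => Filter.EventuallyEq.countable_iUnion fun k => hAt (n + k)
    rwa [Set.iUnion_const, Set.iInter_const] at h1

lemma completionField_futureField_eq (T : Z → Z) (γ : Z → Λ) (q : ℕ) :
    futureField (completionField ℬ π) T γ q = completionField (futureField ℬ T γ q) π := by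
  refine le_antisymm (futureField_le (completionField_mono (le_futureField q)) fun k hk => ?_) ?_
  · exact (partitionField_le_futureField hk).trans le_eventuallyMeasurableSpace
  · rintro s ⟨t, ht, hst⟩
    refine measurableSet_congr_of_completionField_le (ℬ := ℬ) (le_futureField q) (t := t) ?_ hst
    exact (futureField_le (le_eventuallyMeasurableSpace.trans (le_futureField q))
      fun k hk => partitionField_le_futureField hk : futureField ℬ T γ q ≤ _) _ ht

/-- The generator gives `m` only modulo null sets; the completed `ℬ` supplies those null sets and
makes the equality exact. -/
lemma iSup_comap_futureField_eq {T : Z ≃ᵐ Z} {γ : Z → Λ} (hℬm : completionField ℬ π ≤ m)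
    [Countable Λ] (hγ : IsGenerator π T γ) :
    ⨆ p : ℕ, (futureField (completionField ℬ π) T γ 0).comap T.symm^[p] = m := by
  have hγm : partitionField γ ≤ m := partitionField_le_of_blocksIn hγ.measurable
  refine le_antisymm (iSup_le fun p => ?_) fun s hs => ?_
  · exact (MeasurableSpace.comap_mono (futureField_le hℬm fun k _ =>
      partitionField_iterate_le T.measurable hγm k)).trans
        (T.symm.measurable.iterate p).comap_le
  · obtain ⟨t, ht, hst⟩ := hγ.generates.2 s hs
    refine measurableSet_congr_of_completionField_le (ℬ := ℬ) (t := t)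
      (le_iSup_of_le 0 ?_) ?_ (measure_symmDiff_eq_zero_iff.1 hst)
    · rw [Function.iterate_zero, MeasurableSpace.comap_id]
      exact le_futureField 0
    · refine (iSup_le fun k => ?_ : _ ≤ ⨆ p : ℕ,
        (futureField (completionField ℬ π) T γ 0).comap T.symm^[p]) _ ht
      -- A two-sided time is written as j - p with natural numbers, so that T^k γ is a coordinate of
      -- F_0 moved by `T.symm^[p]`.
      obtain ⟨p, j, hk⟩ : ∃ p j : ℕ, k = j - p := ⟨(-k).toNat, k.toNat, by omega⟩
      have e : (fun z => γ (((T.toEquiv : Equiv.Perm Z) ^ k) z)) =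
          (γ ∘ T^[j]) ∘ T.symm^[p] := by
        funext z
        rw [hk, zpow_sub, zpow_natCast, zpow_natCast, ← inv_pow, Equiv.Perm.mul_apply,
          ← Equiv.Perm.iterate_eq_pow, ← Equiv.Perm.iterate_eq_pow]
        rfl
      refine le_iSup_of_le p ?_
      rw [e, ← partitionField_comap]
      exact MeasurableSpace.comap_mono (partitionField_le_futureField (Nat.zero_le j))

end Completion

lemma partitionField_mem_le_iff {ℱ : MeasurableSpace Z} {A : Set Z} :
    partitionField (fun z => z ∈ A) ≤ ℱ ↔ MeasurableSet[ℱ] A := by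
  refine ⟨fun h => h _ ⟨{True}, trivial, by ext; simp⟩, fun h => ?_⟩
  refine partitionField_le_of_blocksIn fun p => ?_
  by_cases hp : p
  · convert h; ext z; simp [hp]
  · convert h.compl; ext z; simp [hp]

lemma tendsto_zero_of_limsup_eq_zero {a : ℕ → ℝ≥0∞} (h : limsup a atTop = 0) :
    Tendsto a atTop (𝓝 0) :=
  tendsto_of_le_liminf_of_limsup_le bot_le h.le

end CondPinsker

/-! ### The theorem -/

open CondPinsker in
theorem mainTheorem10 {Z : Type*} (ℬ : MeasurableSpace Z) [m : MeasurableSpace Z]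
    (π : MeasureTheory.Measure Z) (hZ : CondPinsker.IsLebesgueSpace π)
    (T : Z ≃ᵐ Z) (hT : MeasureTheory.MeasurePreserving T π π)
    (hTaper : CondPinsker.IsAperiodic π T)
    (hTent : CondPinsker.systemEntropy π T < ⊤)
    (hℬ : CondPinsker.IsFactor ℬ π T)
    (hℬent : CondPinsker.factorEntropy ℬ π T < ⊤)
    {Λ : Type*} [Countable Λ] (γ : Z → Λ) (hγ : CondPinsker.IsGenerator π T γ)
    (hγent : CondPinsker.entropy π γ < ⊤) :
    CondPinsker.condPinskerFactor ℬ π T =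
      {A : Set Z | MeasurableSet[CondPinsker.completionField
        (CondPinsker.tailField ℬ T γ) π] A} := by
  have hprob := hZ.isProbabilityMeasure
  have hℬm : completionField ℬ π ≤ m := completionField_le hZ.isComplete hℬ.le
  have hcomap := comap_completionField hT hℬ
  have hγm : partitionField γ ≤ m := partitionField_le_of_blocksIn hγ.measurable
  have htail : tailField ℬ T γ = ⨅ n, futureField ℬ T γ n := rfl
  have hF := futureField_le_of_measurable hℬm hT.measurable hγm
  ext A
  have hmem : MeasurableSet[completionField (tailField ℬ T γ) π] A ↔
      ∀ q, MeasurableSet[futureField (completionField ℬ π) T γ q] A := by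
    rw [htail, measurableSet_completionField_iInf_iff futureField_antitone]
    exact forall_congr' fun q => by rw [completionField_futureField_eq]
  refine Iff.trans ?_ hmem.symm
  -- Completing `ℬ` does not change conditional entropies, so the rate may be computed over the
  -- exactly invariant field.
  have hrate : MeasurableSet A → condEntropyRate ℬ π T (fun z => z ∈ A) =
      limsup (fun n : ℕ => condEntropy (completionField ℬ π) π
        (itinerary T (fun z => z ∈ A) n) / n) atTop := fun hA => by
    have hα := partitionField_mem_le_iff.2 hA
    simp only [condEntropyRate, condEntropy_congr_of_le le_eventuallyMeasurableSpace hℬm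
      subsetMod_completionField (partitionField_itinerary_le_of_measurable T.measurable hα _)]
  refine ⟨fun ⟨hA, h0⟩ q => ?_, fun h => ?_⟩
  · rw [hrate hA] at h0
    refine measurableSet_of_condEntropy_eq_zero (hF q) (fun s t ht hst =>
      measurableSet_congr_of_completionField_le (le_futureField q) ht hst) hA ?_
    exact condEntropy_futureField_eq_zero_of_rate_zero hℬm hT hγm
      (partitionField_mem_le_iff.2 hA) hcomap hγent.ne (iSup_comap_futureField_eq hℬm hγ)
      (tendsto_zero_of_limsup_eq_zero h0) q
  · have hA := hF 0 _ (h 0)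
    refine ⟨hA, ?_⟩
    rw [hrate hA]
    exact limsup_condEntropy_eq_zero_of_le_futureField hℬm hT hγm
      (partitionField_mem_le_iff.2 hA) hcomap hγent.ne
      (fun q => partitionField_mem_le_iff.2 (h q))
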